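/- Let $r_1,\dots,r_N\in\mathbb{R}^3$ be reference vectors. For $Z=(z_1,\dots,z_N)\in(\mathbb{R}^3)^N$, an SVD attitude for $Z$ is any matrix $UV^T$ obtained from a proper singular value decomposition $\sum_{i=1}^N r_iz_i^T=USV^T$, that is, one with $U,V\in SO(3)$ and $S=\mathrm{diag}(s_1,s_2,s_3)$, $s_1\ge s_2\ge|s_3|$. Let $f$ be a measurable map on $(\mathbb{R}^3)^N$ assigning to each $Z$ an SVD attitude for $Z$, and let $\kappa\in\mathbb{R}$ satisfy $\kappa+3N>0$. For a center $Z_0=(z_1,\dots,z_N)$, positive definite $Q_1,\dots,Q_N\in\mathbb{R}^{3\times3}$ and square roots $S_i$ with $S_iS_i^T=(\kappa+3N)Q_i$, let $\Delta_i^{j}$ be the $j$-th column of $S_i$ for $j=1,2,3$, let $\Delta_i^{j}=-\Delta_i^{j-3}$ for $j=4,5,6$, and let $\delta_i^j\in(\mathbb{R}^3)^N$ have $i$-th component $\Delta_i^j$ and all other components $0$. For a matrix-valued function $g$ on $(\mathbb{R}^3)^N$ put $$A(g)=\frac{\kappa}{\kappa+3N}\,g(0)+\sum_{i=1}^N\sum_{j=1}^{6}\frac{1}{2(\kappa+3N)}\,g(\delta_i^j).$$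 The first moment produced by the global unscented transformation is $\widetilde E(R)=A\big(\delta\mapsto f(Z_0+\delta)\big)$. (a) If two of the $r_i$ are linearly independent and $R_0\in SO(3)$, then $R_0$ is the unique SVD attitude for the noise-free measurements $(R_0^Tr_1,\dots,R_0^Tr_N)$. (b) Let $Z_0$ be any point with a unique SVD attitude (for example the one in (a)). Then $f$ is $C^\infty$ at $Z_0$, and there is a constant $C$, depending only on $r_1,\dots,r_N$, $f$, $\kappa$ and $Z_0$, such that the following holds for all positive definite $Q_1,\dots,Q_N$, all $S_i$ as above, and all independent Gaussian errors $v_i\sim\mathcal{N}(0,Q_i)$, $i=1,\dots,N$. Write $\delta Z=(v_1,\dots,v_N)$ and $R=f(Z_0+\delta Z)$. (i) The Taylor expansions of $E(R)$ and $\widetilde E(R)$ at $Z_0$ agree term by term up to third order: for $k=0,1,2,3$, with $D^k_\delta f=(\delta\cdot\nabla)^kf(Z_0)$, the random matrix $D^k_{\delta Z}f$ has a first moment and $E\big(D^k_{\delta Z}f\big)=A\big(\delta\mapsto D^k_\delta f\big)$. (ii) $R$ has a first moment, and the error is of fourth order in the noise: every entry of $E(R)-\widetilde E(R)$ is at most $C\big(\sum_{i=1}^N\operatorname{tr}Q_i\big)^2$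 in absolute value. -/

import Mathlib

open MeasureTheory ProbabilityTheory Matrix

noncomputable section

/-- Three-dimensional Euclidean space. -/
abbrev E3 : Type := EuclideanSpace ℝ (Fin 3)

/-- Real `3 × 3` matrices. -/
abbrev Mat3 : Type := Matrix (Fin 3) (Fin 3) ℝ

/-- `F = U diag(s) Vᵀ` is a proper singular value decomposition:
`U, V ∈ SO(3)` and `s₁ ≥ s₂ ≥ |s₃|`. -/
def IsProperSVD (F U : Mat3) (s : Fin 3 → ℝ) (V : Mat3) : Prop :=
  U ∈ Matrix.specialOrthogonalGroup (Fin 3) ℝ ∧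
  V ∈ Matrix.specialOrthogonalGroup (Fin 3) ℝ ∧
  s 1 ≤ s 0 ∧ |s 2| ≤ s 1 ∧
  F = U * Matrix.diagonal s * Vᵀ

/-- The matrix `∑ᵢ rᵢ zᵢᵀ` built from the reference vectors `r` and the measurements `z`. -/
def attitudeProfile {N : ℕ} (r z : Fin N → E3) : Mat3 :=
  ∑ i, Matrix.vecMulVec (fun a => r i a) (fun b => z i b)

/-- `R` is an attitude returned by the SVD method for the measurements `z`: `R = U Vᵀ` for some
proper singular value decomposition `U S Vᵀ` of `∑ᵢ rᵢ zᵢᵀ`. -/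
def IsSVDAttitude {N : ℕ} (r z : Fin N → E3) (R : Mat3) : Prop :=
  ∃ (U : Mat3) (s : Fin 3 → ℝ) (V : Mat3),
    IsProperSVD (attitudeProfile r z) U s V ∧ R = U * Vᵀ

/-- `f` is a realisation of the SVD method: to every tuple of measurements it assigns (in a
measurable way) an attitude obtained from a proper singular value decomposition. -/
structure IsSVDMethod {N : ℕ} (r : Fin N → E3) (f : (Fin N → E3) → Mat3) : Prop where
  attitude : ∀ Z, IsSVDAttitude r Z (f Z)
  measurable : ∀ a b, Measurable fun Z => f Z a b

/-- The noise-free measurements `Rᵀ rᵢ` of the reference vectors when the attitude is `R`. -/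
def noiseFree {N : ℕ} (r : Fin N → E3) (R : Mat3) : Fin N → E3 :=
  fun i => WithLp.toLp 2 (Rᵀ *ᵥ (fun a => r i a))

/-- The measurement errors `v₁, …, v_N` are independent, and `vᵢ ∼ 𝒩(0, Qᵢ)` with `Qᵢ ≻ 0`. -/
structure IsGaussianNoise {Ω : Type*} [MeasurableSpace Ω] (P : Measure Ω) {N : ℕ}
    (v : Fin N → Ω → E3) (Q : Fin N → Mat3) : Prop where
  posDef : ∀ i, (Q i).PosDef
  law : ∀ i, HasLaw (v i) (multivariateGaussian 0 (Q i)) P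
  indep : iIndepFun v P

/-- `S` is a square root of the covariance-type matrix `A`, i.e. `S Sᵀ = A`. The symmetric square
root and the Cholesky factor are instances. -/
def IsSqrtFactor (S A : Mat3) : Prop := S * Sᵀ = A

/-- The offsets of the `2d = 6` non-central sigma points of one vector measurement: the columns of
the square root `S`, and their negatives. -/
def sigmaOffset (S : Mat3) : Fin 3 ⊕ Fin 3 → E3
  | Sum.inl j => WithLp.toLp 2 (S.col j)
  | Sum.inr j => -WithLp.toLp 2 (S.col j)

/-- The deviation of the `(i, j)`-th sigma point from the centre: only the `i`-th measurement is
displaced, by its `j`-th offset. -/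
def sigmaDeviation {N : ℕ} (S : Fin N → Mat3) (i : Fin N) (j : Fin 3 ⊕ Fin 3) : Fin N → E3 :=
  Pi.single i (sigmaOffset (S i) j)

/-- The weighted sum over the central deviation `0` and all deviations `sigmaDeviation S i j` of
the values of `g`, with weight `κ / (κ + N d)` on the first and `1 / (2 (κ + N d))` on every
other, `d = 3`. -/
def sigmaAverage {N : ℕ} (κ : ℝ) (S : Fin N → Mat3) (g : (Fin N → E3) → Mat3) : Mat3 :=
  (κ / (κ + N * 3)) • g 0 +
    ∑ i, ∑ j, (1 / (2 * (κ + N * 3))) • g (sigmaDeviation S i j)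

/-- The first moment produced by the unscented transformation centred at `z`: the weighted sum of
the SVD attitudes of the sigma points. -/
def unscentedMean {N : ℕ} (κ : ℝ) (S : Fin N → Mat3) (f : (Fin N → E3) → Mat3)
    (z : Fin N → E3) : Mat3 :=
  sigmaAverage κ S fun δ => f (z + δ)

/-- The differential `D^k_δ f = (δ · ∇)^k f (z)`, taken entry by entry: the order-`k` term (up to
the factor `1 / k!`) of the Taylor expansion of `f (z + δ)` at `z`. -/
def taylorTerm {N : ℕ} (f : (Fin N → E3) → Mat3) (z : Fin N → E3) (k : ℕ)
    (δ : Fin N → E3) : Mat3 :=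
  Matrix.of fun a b => iteratedFDeriv ℝ k (fun Z => f Z a b) z fun _ => δ

/-- A random matrix has a first moment: all its entries are integrable. -/
def HasFirstMoment {Ω : Type*} [MeasurableSpace Ω] (P : Measure Ω) (X : Ω → Mat3) : Prop :=
  ∀ a b, Integrable (fun ω => X ω a b) P

/-- The first moment `E(X)` of a random matrix, entry by entry. -/
def firstMoment {Ω : Type*} [MeasurableSpace Ω] (P : Measure Ω) (X : Ω → Mat3) : Mat3 :=
  Matrix.of fun a b => ∫ ω, X ω a b ∂P

end

/-!
The proof has an algebraic, an analytic and a probabilistic ingredient.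

*Attitudes.* An SVD attitude `R` for `F = ∑ rᵢ zᵢᵀ` maximises `tr (F Rᵀ)` over `SO(3)`
(`IsSVDAttitude.trace_le`). For noise-free measurements this trace is `∑ rᵢ ⬝ (R₀ Rᵀ rᵢ)`, so a
maximiser makes `R₀ Rᵀ` fix every `rᵢ`, and a rotation fixing two independent vectors is the
identity.

*Smoothness.* Uniqueness of the attitude forces `s₂ + s₃ > 0` (`exists_properSVD_of_unique`).
Attitudes solve the polynomial equation `MᵀM - 1 + (MᵀF - FᵀM) = 0`, and under that inequality its
linearisation in `M` is injective (`eq_zero_of_linearised`). Compactness of `SO(3)` makes `f`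
continuous at `z`, whence `f` agrees near `z` with the smooth implicit function of the equation
(`IsSVDMethod.contDiffAt`).

*Accuracy.* The noise and the weighted sigma points are both symmetric about the centre and share
their second moments, so they integrate polynomials of degree at most three to the same value
(`integral_multilinear_eq_sigmaSum`). As `f` is bounded and smooth at `z`, its third-order Taylor
remainder is at most `C ‖δ‖ ^ 4` for all `δ`, not only for small ones (`exists_abs_sub_taylor_le`).
Fourth moments of the noise and of the sigma points are `O((∑ tr Qᵢ)²)`: for the noise because
`𝒩(0, Q)` is `Q^(1/2)` times a standard Gaussian vector, for the sigma points because the columns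
of `Sᵢ` have squared norm at most `tr (Sᵢ Sᵢᵀ)`.
-/

/-! ### Rotations of three-dimensional space -/

lemma transpose_mul_self_of_mem {W : Mat3} (hW : W ∈ specialOrthogonalGroup (Fin 3) ℝ) :
    Wᵀ * W = 1 :=
  (mem_orthogonalGroup_iff' (Fin 3) ℝ).1 (mem_specialOrthogonalGroup_iff.1 hW).1

lemma mul_transpose_self_of_mem {W : Mat3} (hW : W ∈ specialOrthogonalGroup (Fin 3) ℝ) :
    W * Wᵀ = 1 :=
  (mem_orthogonalGroup_iff (Fin 3) ℝ).1 (mem_specialOrthogonalGroup_iff.1 hW).1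

lemma mem_specialOrthogonalGroup_of_eq {W : Mat3} (h : Wᵀ * W = 1) (hd : W.det = 1) :
    W ∈ specialOrthogonalGroup (Fin 3) ℝ :=
  mem_specialOrthogonalGroup_iff.2 ⟨(mem_orthogonalGroup_iff' (Fin 3) ℝ).2 h, hd⟩

lemma transpose_mem_specialOrthogonalGroup {W : Mat3}
    (hW : W ∈ specialOrthogonalGroup (Fin 3) ℝ) : Wᵀ ∈ specialOrthogonalGroup (Fin 3) ℝ :=
  mem_specialOrthogonalGroup_of_eq (by simpa using mul_transpose_self_of_mem hW)
    (by simpa using (mem_specialOrthogonalGroup_iff.1 hW).2)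

/-- A rotation is its own cofactor matrix. -/
lemma transpose_eq_adjugate {W : Mat3} (hW : W ∈ specialOrthogonalGroup (Fin 3) ℝ) :
    Wᵀ = W.adjugate := by
  calc Wᵀ = Wᵀ * (W * W.adjugate) := by
        rw [mul_adjugate, (mem_specialOrthogonalGroup_iff.1 hW).2, one_smul, mul_one]
    _ = W.adjugate := by rw [← mul_assoc, transpose_mul_self_of_mem hW, one_mul]

lemma abs_entry_le_one {W : Mat3} (hW : W ∈ specialOrthogonalGroup (Fin 3) ℝ) (a b : Fin 3) :
    |W a b| ≤ 1 := by
  have h := congr_fun₂ (transpose_mul_self_of_mem hW) b b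
  rw [mul_apply, one_apply_eq] at h
  have h2 : W a b * W a b ≤ ∑ c, Wᵀ b c * W c b :=
    Finset.single_le_sum (f := fun c => Wᵀ b c * W c b) (fun c _ => mul_self_nonneg (W c b))
      (Finset.mem_univ a)
  rw [h] at h2
  exact abs_le_one_iff_mul_self_le_one.2 h2

/-- The right-hand side is four times the square of the third imaginary coordinate of a unit
quaternion representing the rotation `W`. -/
lemma diag_inequality {W : Mat3} (hW : W ∈ specialOrthogonalGroup (Fin 3) ℝ) :
    0 ≤ 1 + W 2 2 - W 0 0 - W 1 1 := by
  have ho := transpose_mul_self_of_mem hW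
  have h0 := congr_fun₂ ho 0 0
  have h1 := congr_fun₂ ho 1 1
  have h2 := congr_fun₂ ho 2 2
  have ha := transpose_eq_adjugate hW
  rw [adjugate_fin_three] at ha
  have c0 := congr_fun₂ ha 0 0
  have c1 := congr_fun₂ ha 1 1
  have c2 := congr_fun₂ ha 2 2
  simp [mul_apply, Fin.sum_univ_three] at h0 h1 h2 c0 c1 c2
  -- for a unit quaternion `q`, `4 (4 q₃²) = ∑ l, (4 q₃ qₗ)²`, written in the entries of `W`
  have key : 4 * (1 + W 2 2 - W 0 0 - W 1 1) = (1 + W 2 2 - W 0 0 - W 1 1) ^ 2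
      + (W 1 0 - W 0 1) ^ 2 + (W 0 2 + W 2 0) ^ 2 + (W 1 2 + W 2 1) ^ 2 := by
    linear_combination -h0 - h1 - h2 + 2 * c2 - 2 * c1 - 2 * c0
  have : 0 ≤ 4 * (1 + W 2 2 - W 0 0 - W 1 1) := by rw [key]; positivity
  linarith

/-- Among all rotations `W`, the identity maximises `tr (diag s * W)` when `s₁ ≥ s₂ ≥ |s₃|`. -/
lemma sum_mul_diag_le {W : Mat3} (hW : W ∈ specialOrthogonalGroup (Fin 3) ℝ) {s : Fin 3 → ℝ}
    (h01 : s 1 ≤ s 0) (h12 : |s 2| ≤ s 1) : ∑ i, s i * W i i ≤ ∑ i, s i := by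
  have h := diag_inequality hW
  have w0 := (abs_le.1 (abs_entry_le_one hW 0 0)).2
  have w2 := (abs_le.1 (abs_entry_le_one hW 2 2)).2
  have hs := abs_le.1 h12
  have hs1 : 0 ≤ s 1 := (abs_nonneg _).trans h12
  simp only [Fin.sum_univ_three]
  -- `s₁(1-W₁₁) + s₂(1-W₂₂) + s₃(1-W₃₃) ≥ s₂ ((1-W₁₁) + (1-W₂₂) - (1-W₃₃))`
  nlinarith [mul_nonneg hs1 h, mul_nonneg (sub_nonneg.2 h01) (sub_nonneg.2 w0),
    mul_nonneg (by linarith : 0 ≤ s 1 + s 2) (sub_nonneg.2 w2)]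

/-- Rotations preserve cross products, so a rotation that fixes two linearly independent vectors
fixes the basis completed by their cross product. -/
lemma eq_one_of_fixes_two {W : Mat3} (hW : W ∈ specialOrthogonalGroup (Fin 3) ℝ)
    {a b : Fin 3 → ℝ} (hab : LinearIndependent ℝ ![a, b]) (ha : W *ᵥ a = a) (hb : W *ᵥ b = b) :
    W = 1 := by
  have hc : a ⨯₃ b ≠ 0 := crossProduct_ne_zero_iff_linearIndependent.2 hab
  have hadj := transpose_eq_adjugate hW
  have hcross : W *ᵥ (a ⨯₃ b) = a ⨯₃ b := by
    conv_rhs => rw [← ha, ← hb]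
    rw [adjugate_fin_three] at hadj
    have e := fun i j => congr_fun₂ hadj j i
    simp only [transpose_apply] at e
    ext i
    fin_cases i
    · simp [cross_apply, mulVec, dotProduct, Fin.sum_univ_three]
      rw [e 0 0, e 0 1, e 0 2]
      simp
      ring
    · simp [cross_apply, mulVec, dotProduct, Fin.sum_univ_three]
      rw [e 1 0, e 1 1, e 1 2]
      simp
      ring
    · simp [cross_apply, mulVec, dotProduct, Fin.sum_univ_three]
      rw [e 2 0, e 2 1, e 2 2]
      simp
      ring
  set M : Mat3 := ![a ⨯₃ b, a, b] with hM
  have hdet : M.det ≠ 0 := by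
    rw [hM, ← triple_product_eq_det]
    simpa using hc
  have hWM : W * Mᵀ = Mᵀ := by
    ext i j
    fin_cases j
    · exact congr_fun hcross i
    · exact congr_fun ha i
    · exact congr_fun hb i
  have hu : IsUnit Mᵀ := by rw [isUnit_iff_isUnit_det, det_transpose]; exact hdet.isUnit
  exact hu.mul_right_cancel (by rw [hWM, one_mul])

/-! ### Attitudes produced by the SVD method -/

lemma IsSVDAttitude.mem {N : ℕ} {r z : Fin N → E3} {R : Mat3} (h : IsSVDAttitude r z R) :
    R ∈ specialOrthogonalGroup (Fin 3) ℝ := by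
  obtain ⟨U, s, V, ⟨hU, hV, -⟩, rfl⟩ := h
  exact mul_mem hU (transpose_mem_specialOrthogonalGroup hV)

/-- An SVD attitude `R` for `F = ∑ rᵢ zᵢᵀ` solves Wahba's problem: it maximises `tr (F Rᵀ)` over the
rotation group. -/
lemma IsSVDAttitude.trace_le {N : ℕ} {r z : Fin N → E3} {R R' : Mat3} (h : IsSVDAttitude r z R)
    (hR' : R' ∈ specialOrthogonalGroup (Fin 3) ℝ) :
    (attitudeProfile r z * R'ᵀ).trace ≤ (attitudeProfile r z * Rᵀ).trace := by
  obtain ⟨U, s, V, ⟨hU, hV, h01, h12, hF⟩, rfl⟩ := h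
  have key : ∀ X : Mat3, (attitudeProfile r z * Xᵀ).trace = ∑ i, s i * (Vᵀ * Xᵀ * U) i i := by
    intro X
    rw [hF, mul_assoc, mul_assoc, trace_mul_comm, mul_assoc, trace]
    simp [diagonal_mul]
  rw [key, key]
  have h1 : Vᵀ * (U * Vᵀ)ᵀ * U = 1 := by
    rw [transpose_mul, transpose_transpose, ← mul_assoc, transpose_mul_self_of_mem hV, one_mul,
      transpose_mul_self_of_mem hU]
  rw [h1]
  simpa using sum_mul_diag_le (mul_mem (mul_mem (transpose_mem_specialOrthogonalGroup hV)
    (transpose_mem_specialOrthogonalGroup hR')) hU) h01 h12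

lemma trace_attitudeProfile_mul {N : ℕ} (r z : Fin N → E3) (X : Mat3) :
    (attitudeProfile r z * X).trace = ∑ i, (fun b => z i b) ⬝ᵥ (X *ᵥ fun a => r i a) := by
  simp_rw [attitudeProfile, Finset.sum_mul, trace_sum, vecMulVec_mul, trace_vecMulVec,
    dotProduct_mulVec, dotProduct_comm]

/-- The Cauchy–Schwarz inequality for `x` and `W x`, with its equality case. -/
lemma dotProduct_mulVec_le {W : Mat3} (hW : W ∈ specialOrthogonalGroup (Fin 3) ℝ)
    (x : Fin 3 → ℝ) :
    x ⬝ᵥ W *ᵥ x ≤ x ⬝ᵥ x ∧ (x ⬝ᵥ W *ᵥ x = x ⬝ᵥ x → W *ᵥ x = x) := by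
  have h1 : (W *ᵥ x) ⬝ᵥ (W *ᵥ x) = x ⬝ᵥ x := by
    rw [dotProduct_mulVec, ← mulVec_transpose, mulVec_mulVec, transpose_mul_self_of_mem hW,
      one_mulVec]
  have h2 : (W *ᵥ x - x) ⬝ᵥ (W *ᵥ x - x) = 2 * (x ⬝ᵥ x - x ⬝ᵥ W *ᵥ x) := by
    rw [sub_dotProduct, dotProduct_sub, dotProduct_sub, h1, dotProduct_comm (W *ᵥ x) x]
    ring
  have h3 : 0 ≤ (W *ᵥ x - x) ⬝ᵥ (W *ᵥ x - x) :=
    Finset.sum_nonneg fun i _ => mul_self_nonneg _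
  refine ⟨by linarith, fun h => ?_⟩
  rw [h, sub_self, mul_zero] at h2
  exact sub_eq_zero.1 (dotProduct_self_eq_zero.1 h2)

/-- For noise-free measurements, `tr (F Rᵀ) = ∑ rᵢ ⬝ (R₀ Rᵀ rᵢ)`, so maximality against `R₀` forces
the rotation `R₀ Rᵀ` to fix every reference vector. -/
lemma IsSVDAttitude.eq_of_noiseFree {N : ℕ} {r : Fin N → E3} {R₀ R : Mat3}
    (hR₀ : R₀ ∈ specialOrthogonalGroup (Fin 3) ℝ)
    (hr : ∃ i j, LinearIndependent ℝ ![r i, r j]) (h : IsSVDAttitude r (noiseFree r R₀) R) :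
    R = R₀ := by
  obtain ⟨i, j, hij⟩ := hr
  have hR := h.mem
  have hW : R₀ * Rᵀ ∈ specialOrthogonalGroup (Fin 3) ℝ :=
    mul_mem hR₀ (transpose_mem_specialOrthogonalGroup hR)
  have key : ∀ X : Mat3, (attitudeProfile r (noiseFree r R₀) * X).trace =
      ∑ i, (fun a => r i a) ⬝ᵥ ((R₀ * X) *ᵥ fun a => r i a) := by
    intro X
    rw [trace_attitudeProfile_mul]
    refine Finset.sum_congr rfl fun i _ => ?_
    change (R₀ᵀ *ᵥ (fun a => r i a)) ⬝ᵥ _ = _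
    rw [mulVec_transpose, ← dotProduct_mulVec, mulVec_mulVec]
  have hle := h.trace_le hR₀
  rw [key, key, mul_transpose_self_of_mem hR₀] at hle
  simp only [one_mulVec] at hle
  have hfix : ∀ i, (R₀ * Rᵀ) *ᵥ (fun a => r i a) = fun a => r i a := by
    intro i
    refine (dotProduct_mulVec_le hW _).2 ?_
    exact (Finset.sum_eq_sum_iff_of_le fun i _ => (dotProduct_mulVec_le hW _).1).1
      (le_antisymm (Finset.sum_le_sum fun i _ => (dotProduct_mulVec_le hW _).1) hle) i
      (Finset.mem_univ i)
  have hij' : LinearIndependent ℝ ![fun a => r i a, fun a => r j a] := by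
    refine LinearIndependent.pair_iff.2 fun a b hab => LinearIndependent.pair_iff.1 hij a b ?_
    ext k
    exact congr_fun hab k
  have h1 := eq_one_of_fixes_two hW hij' (hfix i) (hfix j)
  calc R = (R₀ * Rᵀ) * R := by rw [h1, one_mul]
    _ = R₀ := by rw [mul_assoc, transpose_mul_self_of_mem hR, mul_one]

/-- If `s₂ + s₃ = 0`, a quarter turn `J` in the plane of the last two singular vectors satisfies
`J * diag s * J = diag s`; replacing `U, V` by `U J, V Jᵀ` gives a second attitude. Hence
uniqueness forces `s₂ + s₃ > 0`. -/
lemma exists_properSVD_of_unique {N : ℕ} {r z : Fin N → E3} {R : Mat3}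
    (hR : IsSVDAttitude r z R) (huniq : ∀ R', IsSVDAttitude r z R' → R' = R) :
    ∃ U s V, IsProperSVD (attitudeProfile r z) U s V ∧ R = U * Vᵀ ∧ 0 < s 1 + s 2 := by
  obtain ⟨U, s, V, hSVD, hRUV⟩ := hR
  refine ⟨U, s, V, hSVD, hRUV, ?_⟩
  obtain ⟨hU, hV, h01, h12, hF⟩ := hSVD
  by_contra hneg
  have hs : s 2 = - s 1 := by linarith [(abs_le.1 h12).1]
  let J : Mat3 := !![1, 0, 0; 0, 0, -1; 0, 1, 0]
  have hJ : J ∈ specialOrthogonalGroup (Fin 3) ℝ := by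
    refine mem_specialOrthogonalGroup_of_eq ?_ ?_
    · ext i j
      fin_cases i <;> fin_cases j <;> simp [J, mul_apply, Fin.sum_univ_three]
    · simp [J, det_fin_three]
  have hJS : J * diagonal s * J = diagonal s := by
    ext i j
    fin_cases i <;> fin_cases j <;> simp [J, mul_apply, Fin.sum_univ_three, vecMul_diagonal, hs]
  have h2 : IsSVDAttitude r z ((U * J) * (V * Jᵀ)ᵀ) := by
    refine ⟨U * J, s, V * Jᵀ, ⟨mul_mem hU hJ, mul_mem hV (transpose_mem_specialOrthogonalGroup hJ),
      h01, h12, ?_⟩, rfl⟩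
    rw [hF, transpose_mul, transpose_transpose]
    conv_lhs => rw [← hJS]
    simp only [mul_assoc]
  have h3 := huniq _ h2
  rw [hRUV, transpose_mul, transpose_transpose] at h3
  have h4 : J * J = 1 := by
    calc J * J = Uᵀ * (U * J * (J * Vᵀ)) * V := by
          have : Uᵀ * (U * J * (J * Vᵀ)) * V = (Uᵀ * U) * (J * J) * (Vᵀ * V) := by
            simp only [mul_assoc]
          rw [this, transpose_mul_self_of_mem hU, transpose_mul_self_of_mem hV, one_mul, mul_one]
      _ = (Uᵀ * U) * (Vᵀ * V) := by rw [h3]; simp only [mul_assoc]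
      _ = 1 := by rw [transpose_mul_self_of_mem hU, transpose_mul_self_of_mem hV, one_mul]
  have h5 := congr_fun₂ h4 1 1
  simp [J, mul_apply, Fin.sum_univ_three] at h5
  norm_num at h5

/-! ### Smoothness of the SVD method at centres with a unique attitude -/

section Smoothness

open Filter Topology
open scoped Matrix.Norms.Elementwise ContDiff

lemma isClosed_specialOrthogonalGroup :
    IsClosed {W : Mat3 | W ∈ specialOrthogonalGroup (Fin 3) ℝ} := by
  have : {W : Mat3 | W ∈ specialOrthogonalGroup (Fin 3) ℝ} = {W | Wᵀ * W = 1} ∩ {W | W.det = 1} :=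
    Set.ext fun W => ⟨fun h =>
      ⟨transpose_mul_self_of_mem h, (mem_specialOrthogonalGroup_iff.1 h).2⟩,
      fun h => mem_specialOrthogonalGroup_of_eq h.1 h.2⟩
  rw [this]
  exact (isClosed_eq (by fun_prop) continuous_const).inter
    (isClosed_eq (continuous_id.matrix_det) continuous_const)

lemma isCompact_specialOrthogonalGroup :
    IsCompact {W : Mat3 | W ∈ specialOrthogonalGroup (Fin 3) ℝ} := by
  refine IsCompact.of_isClosed_subset (isCompact_univ_pi fun _ : Fin 3 =>
    isCompact_univ_pi fun _ : Fin 3 => isCompact_Icc (a := (-1 : ℝ)) (b := 1))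
    isClosed_specialOrthogonalGroup ?_
  intro W hW i _ j _
  exact abs_le.1 (abs_entry_le_one hW i j)

lemma attitudeProfile_apply {N : ℕ} (r z : Fin N → E3) (a b : Fin 3) :
    attitudeProfile r z a b = ∑ i, r i a * z i b := by
  simp [attitudeProfile, Matrix.sum_apply, vecMulVec_apply]

lemma contDiff_attitudeProfile {N : ℕ} (r : Fin N → E3) :
    ContDiff ℝ ∞ (attitudeProfile r) := by
  refine contDiff_pi.2 fun a => contDiff_pi.2 fun b => ?_
  simp_rw [attitudeProfile_apply]
  fun_prop

/-- Proper singular value decompositions survive limits because `SO(3)` is compact, so any limit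
point of `f` at `z` is an SVD attitude for `z`. -/
lemma IsSVDMethod.tendsto_of_unique {N : ℕ} {r : Fin N → E3} {f : (Fin N → E3) → Mat3}
    (hf : IsSVDMethod r f) {z : Fin N → E3} {R : Mat3}
    (huniq : ∀ R', IsSVDAttitude r z R' → R' = R) : Tendsto f (𝓝 z) (𝓝 R) := by
  choose U s V hSVD hUV using hf.attitude
  rw [tendsto_iff_ultrafilter]
  intro g hg
  obtain ⟨U₀, hU₀, hU⟩ := isCompact_specialOrthogonalGroup.ultrafilter_le_nhds (g.map U)
    (le_principal_iff.2 (mem_map.2 (univ_mem' fun Z => (hSVD Z).1)))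
  obtain ⟨V₀, hV₀, hV⟩ := isCompact_specialOrthogonalGroup.ultrafilter_le_nhds (g.map V)
    (le_principal_iff.2 (mem_map.2 (univ_mem' fun Z => (hSVD Z).2.1)))
  replace hU : Tendsto U g (𝓝 U₀) := hU
  replace hV : Tendsto V g (𝓝 V₀) := hV
  have hF : Tendsto (attitudeProfile r) g (𝓝 (attitudeProfile r z)) :=
    ((contDiff_attitudeProfile r).continuous.tendsto z).mono_left hg
  have hD : ∀ Z, diagonal (s Z) = (U Z)ᵀ * attitudeProfile r Z * V Z := by
    intro Z
    obtain ⟨h1, h2, -, -, h5⟩ := hSVD Z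
    rw [h5]
    calc diagonal (s Z) = ((U Z)ᵀ * U Z) * diagonal (s Z) * ((V Z)ᵀ * V Z) := by
          rw [transpose_mul_self_of_mem h1, transpose_mul_self_of_mem h2, one_mul, mul_one]
      _ = _ := by simp only [mul_assoc]
  have hT : ∀ {M : (Fin N → E3) → Mat3} {M₀ : Mat3}, Tendsto M g (𝓝 M₀) →
      Tendsto (fun Z => (M Z)ᵀ) g (𝓝 M₀ᵀ) := fun h =>
    ((continuous_id.matrix_transpose).tendsto _).comp h
  have hlimD : Tendsto (fun Z => diagonal (s Z)) g (𝓝 (U₀ᵀ * attitudeProfile r z * V₀)) := by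
    simp_rw [hD]
    exact ((hT hU).mul hF).mul hV
  set D := U₀ᵀ * attitudeProfile r z * V₀ with hDdef
  have hent : ∀ i j, Tendsto (fun Z => diagonal (s Z) i j) g (𝓝 (D i j)) := fun i j =>
    tendsto_pi_nhds.1 (tendsto_pi_nhds.1 hlimD i) j
  have hs : ∀ i, Tendsto (fun Z => s Z i) g (𝓝 (D i i)) := fun i => by
    simpa using hent i i
  have hdiag : diagonal (fun i => D i i) = D := by
    ext i j
    by_cases hij : i = j
    · subst hij; simp
    · rw [diagonal_apply_ne _ hij]
      refine tendsto_nhds_unique ?_ (hent i j)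
      simp [diagonal_apply_ne _ hij]
  have hatt : IsSVDAttitude r z (U₀ * V₀ᵀ) := by
    refine ⟨U₀, fun i => D i i, V₀, ⟨hU₀, hV₀, le_of_tendsto_of_tendsto' (hs 1) (hs 0)
      fun Z => (hSVD Z).2.2.1, le_of_tendsto_of_tendsto' (hs 2).abs (hs 1)
      fun Z => (hSVD Z).2.2.2.1, ?_⟩, rfl⟩
    rw [hdiag, hDdef]
    calc attitudeProfile r z = (U₀ * U₀ᵀ) * attitudeProfile r z * (V₀ * V₀ᵀ) := by
          rw [mul_transpose_self_of_mem hU₀, mul_transpose_self_of_mem hV₀, one_mul, mul_one]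
      _ = _ := by simp only [mul_assoc]
  rw [← huniq _ hatt]
  have : f = fun Z => U Z * (V Z)ᵀ := funext hUV
  rw [this]
  exact hU.mul (hT hV)

/-- The left-hand side of the equation `MᵀM - 1 + (MᵀF - FᵀM) = 0` for an attitude `M` of the
profile matrix `F`, where `p = (F, M)`. Its symmetric part says that `M` is orthogonal and its
antisymmetric part that `MᵀF` is symmetric. -/
def svdEquation (p : Mat3 × Mat3) : Mat3 :=
  p.2ᵀ * p.2 - 1 + (p.2ᵀ * p.1 - p.1ᵀ * p.2)

lemma contDiff_svdEquation : ContDiff ℝ ∞ svdEquation := by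
  have h1 : ∀ i j, ContDiff ℝ ∞ fun p : Mat3 × Mat3 => p.1 i j := fun i j =>
    contDiff_pi.1 (contDiff_pi.1 contDiff_fst i) j
  have h2 : ∀ i j, ContDiff ℝ ∞ fun p : Mat3 × Mat3 => p.2 i j := fun i j =>
    contDiff_pi.1 (contDiff_pi.1 contDiff_snd i) j
  refine contDiff_pi.2 fun a => contDiff_pi.2 fun b => ?_
  simp only [svdEquation, Matrix.add_apply, Matrix.sub_apply, mul_apply, transpose_apply]
  fun_prop

lemma IsSVDAttitude.svdEquation_eq_zero {N : ℕ} {r z : Fin N → E3} {R : Mat3}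
    (h : IsSVDAttitude r z R) : svdEquation (attitudeProfile r z, R) = 0 := by
  have hR := h.mem
  obtain ⟨U, s, V, ⟨hU, hV, -, -, hF⟩, rfl⟩ := h
  have h1 : (U * Vᵀ)ᵀ * attitudeProfile r z = V * diagonal s * Vᵀ := by
    rw [hF, transpose_mul, transpose_transpose]
    calc V * Uᵀ * (U * diagonal s * Vᵀ) = V * (Uᵀ * U) * diagonal s * Vᵀ := by
          simp only [mul_assoc]
      _ = _ := by rw [transpose_mul_self_of_mem hU, mul_one]
  have h2 : (attitudeProfile r z)ᵀ * (U * Vᵀ) = V * diagonal s * Vᵀ := by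
    have := congr_arg transpose h1
    simpa [transpose_mul, mul_assoc] using this
  rw [svdEquation, h1, h2, transpose_mul_self_of_mem hR]
  simp

lemma fderiv_svdEquation_inr (F M X : Mat3) :
    fderiv ℝ svdEquation (F, M) (0, X) = Xᵀ * M + Mᵀ * X + (Xᵀ * F - Fᵀ * X) := by
  have h1 : HasFDerivAt svdEquation (fderiv ℝ svdEquation (F, M)) (F, M) :=
    (contDiff_svdEquation.differentiable (by simp)).differentiableAt.hasFDerivAt
  have h2 : HasDerivAt (fun t : ℝ => svdEquation ((F, M) + t • ((0 : Mat3), X)))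
      (fderiv ℝ svdEquation (F, M) (0, X)) 0 := by
    have h3 : HasDerivAt (fun t : ℝ => (F, M) + t • ((0 : Mat3), X)) ((0 : Mat3), X) 0 := by
      have := ((hasDerivAt_id (0 : ℝ)).smul_const ((0 : Mat3), X)).const_add (F, M)
      rwa [one_smul] at this
    have h1' : HasFDerivAt svdEquation (fderiv ℝ svdEquation (F, M))
        ((F, M) + (0 : ℝ) • ((0 : Mat3), X)) := by
      rwa [zero_smul, add_zero]
    exact h1'.comp_hasDerivAt (0 : ℝ) h3
  have h4 : (fun t : ℝ => svdEquation ((F, M) + t • ((0 : Mat3), X))) = fun t : ℝ =>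
      svdEquation (F, M) + (t • (Xᵀ * M + Mᵀ * X + (Xᵀ * F - Fᵀ * X)) + t ^ 2 • (Xᵀ * X)) := by
    funext t
    simp only [svdEquation, Prod.mk_add_mk, Prod.smul_mk, smul_zero, add_zero, transpose_add,
      transpose_smul, add_mul, mul_add, smul_mul_assoc, mul_smul_comm, smul_add, smul_sub, smul_smul,
      pow_two]
    abel
  rw [h4] at h2
  have h5 := (((hasDerivAt_id (0 : ℝ)).smul_const (Xᵀ * M + Mᵀ * X + (Xᵀ * F - Fᵀ * X))).add
    ((hasDerivAt_pow 2 (0 : ℝ)).smul_const (Xᵀ * X))).const_add (svdEquation (F, M))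
  simpa using h2.unique h5

/-- With `Y = Vᵀ (Rᵀ X) V`, the linearised equation splits into `Yᵀ + Y = 0` and
`Y * diag s + diag s * Y = 0`, i.e. `(sᵢ + sⱼ) Yᵢⱼ = 0`. -/
lemma eq_zero_of_linearised {F U V X : Mat3} {s : Fin 3 → ℝ} (h : IsProperSVD F U s V)
    (hs : 0 < s 1 + s 2)
    (hX : Xᵀ * (U * Vᵀ) + (U * Vᵀ)ᵀ * X + (Xᵀ * F - Fᵀ * X) = 0) : X = 0 := by
  obtain ⟨hU, hV, h01, h12, hF⟩ := h
  set Y : Mat3 := Uᵀ * X * V with hY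
  have hXY : X = U * Y * Vᵀ := by
    calc X = (U * Uᵀ) * X * (V * Vᵀ) := by
          rw [mul_transpose_self_of_mem hU, mul_transpose_self_of_mem hV, one_mul, mul_one]
      _ = _ := by simp only [hY, mul_assoc]
  have hU' : ∀ A : Mat3, Uᵀ * (U * A) = A := fun A => by
    rw [← mul_assoc, transpose_mul_self_of_mem hU, one_mul]
  have hV' : ∀ A : Mat3, Vᵀ * (V * A) = A := fun A => by
    rw [← mul_assoc, transpose_mul_self_of_mem hV, one_mul]
  have hE : Yᵀ + Y + (Yᵀ * diagonal s - diagonal s * Y) = 0 := by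
    have h1 : Vᵀ * (Xᵀ * (U * Vᵀ) + (U * Vᵀ)ᵀ * X + (Xᵀ * F - Fᵀ * X)) * V = 0 := by
      rw [hX, mul_zero, zero_mul]
    rw [hXY, hF] at h1
    simpa [transpose_mul, mul_add, add_mul, mul_sub, sub_mul, mul_assoc, hU', hV',
      transpose_mul_self_of_mem hV] using h1
  have hent : ∀ i j, Y j i + Y i j + (Y j i * s j - s i * Y i j) = 0 := fun i j => by
    simpa using congr_fun₂ hE i j
  have hY0 : Y = 0 := by
    have hs1 : 0 < s 0 + s 1 := by linarith [abs_le.1 h12]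
    have hs2 : 0 < s 0 + s 2 := by linarith
    have key : ∀ i j, 0 < s i + s j → Y i j = 0 := by
      intro i j hij
      have h1 := hent i j
      have h2 := hent j i
      have h3 : Y j i = - Y i j := by linarith
      rw [h3] at h1
      have h4 : Y i j * (s i + s j) = 0 := by linarith
      exact (mul_eq_zero.1 h4).resolve_right hij.ne'
    have hdiag : ∀ i, Y i i = 0 := fun i => by have := hent i i; linarith
    ext i j
    fin_cases i <;> fin_cases j
    exacts [hdiag 0, key 0 1 hs1, key 0 2 hs2, key 1 0 (by linarith), hdiag 1, key 1 2 hs,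
      key 2 0 (by linarith), key 2 1 (by linarith), hdiag 2]
  rw [hXY, hY0, mul_zero, zero_mul]

/-- Near `z` the method solves `svdEquation`, whose partial derivative in `M` is invertible, and is
continuous at `z`; so it coincides with the implicit function of that equation. -/
theorem IsSVDMethod.contDiffAt {N : ℕ} {r : Fin N → E3} {f : (Fin N → E3) → Mat3}
    (hf : IsSVDMethod r f) {z : Fin N → E3} (hz : ∃! R, IsSVDAttitude r z R) :
    ContDiffAt ℝ ∞ f z := by
  obtain ⟨R, hR, huniq⟩ := hz
  obtain ⟨U, s, V, hSVD, hRUV, hs⟩ := exists_properSVD_of_unique hR huniq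
  set F := attitudeProfile r z with hF
  have hcd : ContDiffAt ℝ ∞ svdEquation (F, R) := contDiff_svdEquation.contDiffAt
  have hinv : (fderiv ℝ svdEquation (F, R) ∘L .inr ℝ Mat3 Mat3).IsInvertible := by
    have hinj : Function.Injective
        (fderiv ℝ svdEquation (F, R) ∘L .inr ℝ Mat3 Mat3 : Mat3 →L[ℝ] Mat3).toLinearMap := by
      refine (injective_iff_map_eq_zero _).2 fun X hX => ?_
      have : fderiv ℝ svdEquation (F, R) (0, X) = 0 := hX
      rw [fderiv_svdEquation_inr, hRUV] at this
      exact eq_zero_of_linearised hSVD hs this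
    exact ⟨(LinearEquiv.ofInjectiveEndo _ hinj).toContinuousLinearEquiv, by ext1 X; rfl⟩
  have hne : (∞ : WithTop ℕ∞) ≠ 0 := by simp
  have hψ := ContDiffAt.contDiffAt_implicitFunction hcd hne hinv
  have hev := hcd.eventually_apply_eq_iff_implicitFunction hne hinv
  have hlim : Tendsto (fun Z => (attitudeProfile r Z, f Z)) (𝓝 z) (𝓝 (F, R)) :=
    ((contDiff_attitudeProfile r).continuous.tendsto z).prodMk_nhds (hf.tendsto_of_unique huniq)
  have heq : f =ᶠ[𝓝 z] fun Z => hcd.implicitFunction hne hinv (attitudeProfile r Z) := by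
    filter_upwards [hlim.eventually hev] with Z hZ
    refine (hZ.1 ?_).symm
    rw [(hf.attitude Z).svdEquation_eq_zero, hR.svdEquation_eq_zero]
  exact (hψ.comp z (contDiff_attitudeProfile r).contDiffAt).congr_of_eventuallyEq heq

lemma IsSVDMethod.contDiffAt_apply {N : ℕ} {r : Fin N → E3} {f : (Fin N → E3) → Mat3}
    (hf : IsSVDMethod r f) {z : Fin N → E3} (hz : ∃! R, IsSVDAttitude r z R) (a b : Fin 3) :
    ContDiffAt ℝ ∞ (fun Z => f Z a b) z :=
  contDiffAt_pi.1 (contDiffAt_pi.1 (hf.contDiffAt hz) a) b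

end Smoothness

/-! ### A global Taylor bound for bounded functions -/

section Taylor

open Filter Topology

variable {E : Type*} [NormedAddCommGroup E] [NormedSpace ℝ E]

lemma iteratedDeriv_comp_line {G : E → ℝ} {n : ℕ} (hG : ContDiff ℝ n G) (z δ : E) {k : ℕ}
    (hk : k ≤ n) (t : ℝ) :
    iteratedDeriv k (fun t : ℝ => G (z + t • δ)) t =
      iteratedFDeriv ℝ k G (z + t • δ) fun _ => δ := by
  let L : ℝ →L[ℝ] E := ContinuousLinearMap.toSpanSingleton ℝ δ
  have h1 : ContDiff ℝ n fun x => G (z + x) := hG.comp (contDiff_const.add contDiff_id)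
  have h2 := L.iteratedFDeriv_comp_right h1 t (i := k) (by exact_mod_cast hk)
  rw [iteratedDeriv_eq_iteratedFDeriv]
  change (iteratedFDeriv ℝ k ((fun x => G (z + x)) ∘ L) t) (fun _ => 1) = _
  rw [h2, iteratedFDeriv_comp_add_left]
  simp [L]

lemma abs_sub_taylor_le {G : E → ℝ} {n : ℕ} (hG : ContDiff ℝ (n + 1 : ℕ) G) {C : ℝ}
    (hC : ∀ x, ‖iteratedFDeriv ℝ (n + 1) G x‖ ≤ C) (z δ : E) :
    |G (z + δ) - ∑ k ∈ Finset.range (n + 1),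
      ((k.factorial : ℝ)⁻¹) * iteratedFDeriv ℝ k G z fun _ => δ| ≤ C * ‖δ‖ ^ (n + 1) := by
  set φ : ℝ → ℝ := fun t => G (z + t • δ) with hφdef
  have hφ : ContDiff ℝ (n + 1 : ℕ) φ := hG.comp (by fun_prop)
  obtain ⟨t, -, ht⟩ := taylor_mean_remainder_lagrange_iteratedDeriv (f := φ) (n := n)
    (x₀ := 0) (x := 1) (by norm_num) (by exact_mod_cast hφ.contDiffOn)
  have hT : taylorWithinEval φ n (Set.uIcc 0 1) 0 1 = ∑ k ∈ Finset.range (n + 1),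
      ((k.factorial : ℝ)⁻¹) * iteratedFDeriv ℝ k G z fun _ => δ := by
    rw [taylor_within_apply]
    refine Finset.sum_congr rfl fun k hk => ?_
    have hk' : k ≤ n + 1 := (Finset.mem_range.1 hk).le
    rw [iteratedDerivWithin_eq_iteratedDeriv (uniqueDiffOn_uIcc (by norm_num))
      (hφ.contDiffAt.of_le (by exact_mod_cast hk')) Set.left_mem_uIcc,
      iteratedDeriv_comp_line hG z δ hk']
    simp
  rw [hT, iteratedDeriv_comp_line hG z δ le_rfl] at ht
  have hφ1 : φ 1 = G (z + δ) := by simp [hφdef]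
  rw [← hφ1, ht, sub_zero, one_pow, mul_one, abs_div, Nat.abs_cast]
  have h1 : |iteratedFDeriv ℝ (n + 1) G (z + t • δ) fun _ => δ| ≤ C * ‖δ‖ ^ (n + 1) := by
    refine ((iteratedFDeriv ℝ (n + 1) G (z + t • δ)).le_opNorm _).trans ?_
    simp only [Finset.prod_const, Finset.card_univ, Fintype.card_fin]
    gcongr
    exact hC _
  have h2 : (1 : ℝ) ≤ ((n + 1).factorial : ℝ) := by
    exact_mod_cast Nat.succ_le_of_lt (Nat.factorial_pos _)
  exact (div_le_self (abs_nonneg _) h2).trans h1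

lemma exists_contDiff_hasCompactSupport_eventuallyEq [FiniteDimensional ℝ E] {g : E → ℝ} {z : E}
    {n : ℕ} (hg : ContDiffAt ℝ n g z) :
    ∃ G : E → ℝ, ContDiff ℝ n G ∧ HasCompactSupport G ∧ G =ᶠ[𝓝 z] g := by
  obtain ⟨ρ, hρ, hball⟩ := Metric.eventually_nhds_iff_ball.1 (hg.eventually (by simp))
  let χ : ContDiffBump z := ⟨ρ / 4, ρ / 2, by linarith, by linarith⟩
  refine ⟨fun x => χ x * g x, contDiff_iff_contDiffAt.2 fun x => ?_, χ.hasCompactSupport.mul_right,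
    ?_⟩
  · by_cases hx : x ∈ tsupport χ
    · rw [χ.tsupport_eq] at hx
      refine χ.contDiffAt.mul (hball x ?_)
      exact lt_of_le_of_lt (Metric.mem_closedBall.1 hx) (by change ρ / 2 < ρ; linarith)
    · refine (contDiffAt_const (c := (0 : ℝ))).congr_of_eventuallyEq ?_
      filter_upwards [notMem_tsupport_iff_eventuallyEq.1 hx] with y hy
      simp [hy]
  · filter_upwards [χ.eventuallyEq_one] with x hx
    simp [hx]

/-- Taylor's theorem at `z` with a remainder bounded on the whole space: near `z` the function is
replaced by a compactly supported one, and away from `z` both are bounded, hence dominated by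
`‖δ‖ ^ (n + 1)`. -/
lemma exists_abs_sub_taylor_le [FiniteDimensional ℝ E] {g : E → ℝ} {z : E} {n : ℕ}
    (hg : ContDiffAt ℝ (n + 1 : ℕ) g z) {B : ℝ} (hB : ∀ x, |g x| ≤ B) :
    ∃ C, 0 ≤ C ∧ ∀ δ, |g (z + δ) - ∑ k ∈ Finset.range (n + 1),
      ((k.factorial : ℝ)⁻¹) * iteratedFDeriv ℝ k g z fun _ => δ| ≤ C * ‖δ‖ ^ (n + 1) := by
  obtain ⟨G, hG, hGc, hGg⟩ := exists_contDiff_hasCompactSupport_eventuallyEq hg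
  obtain ⟨C₁, hC₁⟩ := (hGc.iteratedFDeriv (𝕜 := ℝ) (n + 1)).exists_bound_of_continuous
    (hG.continuous_iteratedFDeriv (by exact_mod_cast le_rfl))
  obtain ⟨C₂, hC₂⟩ := hGc.exists_bound_of_continuous hG.continuous
  obtain ⟨ρ, hρ, hball⟩ := Metric.eventually_nhds_iff_ball.1 hGg
  have hB0 : 0 ≤ B := (abs_nonneg _).trans (hB z)
  have hC₁0 : 0 ≤ C₁ := (norm_nonneg _).trans (hC₁ z)
  have hC₂0 : 0 ≤ C₂ := (norm_nonneg _).trans (hC₂ z)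
  refine ⟨C₁ + (B + C₂) / ρ ^ (n + 1), by positivity, fun δ => ?_⟩
  have hT : ∀ k, iteratedFDeriv ℝ k g z = iteratedFDeriv ℝ k G z := fun k =>
    ((hGg.iteratedFDeriv ℝ k).eq_of_nhds).symm
  simp_rw [hT]
  have hfar : |g (z + δ) - G (z + δ)| ≤ (B + C₂) / ρ ^ (n + 1) * ‖δ‖ ^ (n + 1) := by
    by_cases hδ : ‖δ‖ < ρ
    · rw [hball (z + δ) (by simpa using hδ), sub_self, abs_zero]
      positivity
    · rw [div_mul_eq_mul_div, le_div_iff₀ (by positivity)]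
      have h1 : |g (z + δ) - G (z + δ)| ≤ B + C₂ :=
        (abs_sub _ _).trans (add_le_add (hB _) (hC₂ _))
      have h2 : ρ ^ (n + 1) ≤ ‖δ‖ ^ (n + 1) := pow_le_pow_left₀ hρ.le (not_lt.1 hδ) _
      exact mul_le_mul h1 h2 (by positivity) (by positivity)
  calc _ ≤ |g (z + δ) - G (z + δ)| + |G (z + δ) - ∑ k ∈ Finset.range (n + 1),
      ((k.factorial : ℝ)⁻¹) * iteratedFDeriv ℝ k G z fun _ => δ| := abs_sub_le _ _ _
    _ ≤ _ := by
      rw [add_mul, add_comm]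
      exact add_le_add (abs_sub_taylor_le hG hC₁ z δ) hfar

end Taylor

/-! ### Moments of Gaussian measurement errors -/

section Gaussian

/-- The joint law of independent errors `vᵢ ∼ 𝒩(0, Qᵢ)`. -/
noncomputable def noiseLaw {N : ℕ} (Q : Fin N → Mat3) : Measure (Fin N → E3) :=
  Measure.pi fun i => multivariateGaussian 0 (Q i)

instance {N : ℕ} (Q : Fin N → Mat3) : IsProbabilityMeasure (noiseLaw Q) :=
  inferInstanceAs (IsProbabilityMeasure (Measure.pi _))

lemma IsGaussianNoise.hasLaw {Ω : Type*} [MeasurableSpace Ω] {P : Measure Ω} {N : ℕ}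
    {v : Fin N → Ω → E3} {Q : Fin N → Mat3} (h : IsGaussianNoise P v Q) :
    HasLaw (fun ω i => v i ω) (noiseLaw Q) P :=
  h.indep.hasLaw_pi h.law

lemma measurePreserving_eval_noiseLaw {N : ℕ} (Q : Fin N → Mat3) (i : Fin N) :
    MeasurePreserving (fun x : Fin N → E3 => x i) (noiseLaw Q) (multivariateGaussian 0 (Q i)) :=
  measurePreserving_eval (fun i => multivariateGaussian (0 : E3) (Q i)) i

lemma measurePreserving_neg_multivariateGaussian (A : Mat3) :
    MeasurePreserving (fun x : E3 => -x) (multivariateGaussian 0 A) (multivariateGaussian 0 A) := by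
  refine ⟨measurable_neg, ?_⟩
  have h : (stdGaussian E3).map (fun x => -x) = stdGaussian E3 :=
    stdGaussian_map (LinearIsometryEquiv.neg ℝ (E := E3))
  rw [multivariateGaussian, Measure.map_map (by fun_prop) (by fun_prop)]
  conv_rhs => rw [← h, Measure.map_map (by fun_prop) (by fun_prop)]
  congr 1
  ext1 x
  simp

/-- The law of the noise is invariant under changing the signs of some of the errors. -/
lemma measurePreserving_sign_noiseLaw {N : ℕ} (Q : Fin N → Mat3) {ε : Fin N → ℝ}
    (hε : ∀ i, ε i = 1 ∨ ε i = -1) :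
    MeasurePreserving (fun (x : Fin N → E3) i => ε i • x i) (noiseLaw Q) (noiseLaw Q) := by
  refine measurePreserving_pi _ _ fun i => ?_
  change MeasurePreserving (fun y : E3 => ε i • y) _ _
  rcases hε i with h | h
  · simp_rw [h, one_smul]
    exact MeasurePreserving.id _
  · simp_rw [h, neg_one_smul]
    exact measurePreserving_neg_multivariateGaussian (Q i)

lemma integral_noiseLaw_eq_zero_of_sign {N : ℕ} (Q : Fin N → Mat3) {ε : Fin N → ℝ}
    (hε : ∀ i, ε i = 1 ∨ ε i = -1) {g : (Fin N → E3) → ℝ} (hg : Continuous g)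
    (hodd : ∀ x, g (fun i => ε i • x i) = -g x) : ∫ x, g x ∂noiseLaw Q = 0 := by
  have hp := measurePreserving_sign_noiseLaw Q hε
  have h : ∫ x, g x ∂noiseLaw Q = -∫ x, g x ∂noiseLaw Q := by
    conv_lhs => rw [← hp.map_eq, integral_map hp.measurable.aemeasurable
      hg.aestronglyMeasurable]
    simp_rw [hodd, integral_neg]
  linarith

lemma norm_pow_le_sum {N : ℕ} (x : Fin N → E3) {n : ℕ} (hn : n ≠ 0) :
    ‖x‖ ^ n ≤ ∑ i, ‖x i‖ ^ n := by
  rcases isEmpty_or_nonempty (Fin N) with _ | _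
  · simp [Subsingleton.elim x 0, hn]
  · obtain ⟨i, hi⟩ := Finite.exists_max fun i => ‖x i‖
    have : ‖x‖ ≤ ‖x i‖ := (pi_norm_le_iff_of_nonneg (norm_nonneg _)).2 hi
    exact (pow_le_pow_left₀ (norm_nonneg _) this n).trans
      (Finset.single_le_sum (f := fun i => ‖x i‖ ^ n) (fun i _ => by positivity)
        (Finset.mem_univ i))

lemma integrable_norm_pow_of_isGaussian (μ : Measure E3) [IsGaussian μ] (n : ℕ) :
    Integrable (fun x => ‖x‖ ^ n) μ :=
  (IsGaussian.memLp_id μ n (by simp)).integrable_norm_pow'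

lemma integrable_norm_apply_pow_noiseLaw {N : ℕ} (Q : Fin N → Mat3) (i : Fin N) (n : ℕ) :
    Integrable (fun x : Fin N → E3 => ‖x i‖ ^ n) (noiseLaw Q) :=
  (measurePreserving_eval_noiseLaw Q i).integrable_comp_of_integrable
    (integrable_norm_pow_of_isGaussian _ n)

lemma integrable_norm_pow_noiseLaw {N : ℕ} (Q : Fin N → Mat3) (n : ℕ) :
    Integrable (fun x : Fin N → E3 => ‖x‖ ^ n) (noiseLaw Q) := by
  rcases eq_or_ne n 0 with rfl | hn
  · simp
  · refine (integrable_finsetSum Finset.univ fun i _ =>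
      integrable_norm_apply_pow_noiseLaw Q i n).mono' (by fun_prop) (.of_forall fun x => ?_)
    rw [Real.norm_eq_abs, abs_of_nonneg (by positivity)]
    exact norm_pow_le_sum x hn

lemma integrable_multilinear_noiseLaw {N k : ℕ} (Q : Fin N → Mat3)
    (m : ContinuousMultilinearMap ℝ (fun _ : Fin k => Fin N → E3) ℝ) :
    Integrable (fun x => m fun _ => x) (noiseLaw Q) := by
  refine ((integrable_norm_pow_noiseLaw Q k).const_mul ‖m‖).mono'
    (m.cont.comp (continuous_pi fun _ => continuous_id)).aestronglyMeasurable
    (.of_forall fun x => ?_)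
  simpa using m.le_opNorm fun _ => x

lemma abs_apply_le_norm {N : ℕ} (x : Fin N → E3) (p : Fin N × Fin 3) : |x p.1 p.2| ≤ ‖x‖ :=
  (PiLp.norm_apply_le (x p.1) p.2).trans (norm_le_pi_norm x p.1)

lemma integrable_mul_noiseLaw {N : ℕ} (Q : Fin N → Mat3) (p q : Fin N × Fin 3) :
    Integrable (fun x : Fin N → E3 => x p.1 p.2 * x q.1 q.2) (noiseLaw Q) := by
  refine (integrable_norm_pow_noiseLaw Q 2).mono' (by fun_prop) (.of_forall fun x => ?_)
  rw [Real.norm_eq_abs, abs_mul, pow_two]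
  exact mul_le_mul (abs_apply_le_norm x p) (abs_apply_le_norm x q) (abs_nonneg _) (norm_nonneg _)

lemma integral_mul_noiseLaw {N : ℕ} {Q : Fin N → Mat3} (hQ : ∀ i, (Q i).PosDef)
    (p q : Fin N × Fin 3) :
    ∫ x : Fin N → E3, x p.1 p.2 * x q.1 q.2 ∂noiseLaw Q =
      if p.1 = q.1 then Q p.1 p.2 q.2 else 0 := by
  obtain ⟨i, a⟩ := p
  obtain ⟨j, b⟩ := q
  dsimp only
  split_ifs with h
  · subst h
    have hp := measurePreserving_eval_noiseLaw Q i
    have h1 : ∫ x : Fin N → E3, x i a * x i b ∂noiseLaw Q =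
        ∫ y : E3, y a * y b ∂multivariateGaussian 0 (Q i) := by
      rw [← hp.map_eq, integral_map hp.measurable.aemeasurable]
      exact Continuous.aestronglyMeasurable (by fun_prop)
    have hm : ∀ c : Fin 3, ∫ y : E3, y c ∂multivariateGaussian 0 (Q i) = 0 := fun c => by
      have := (EuclideanSpace.proj c : E3 →L[ℝ] ℝ).integral_comp_id_comm
        (IsGaussian.integrable_id (μ := multivariateGaussian (0 : E3) (Q i)))
      simpa using this
    have hL : ∀ c : Fin 3, MemLp (fun y : E3 => y c) 2 (multivariateGaussian 0 (Q i)) := fun c =>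
      (IsGaussian.memLp_two_id (μ := multivariateGaussian (0 : E3) (Q i))).continuousLinearMap_comp
        (EuclideanSpace.proj c : E3 →L[ℝ] ℝ)
    have hcov := covariance_eval_multivariateGaussian (μ := (0 : E3)) (hQ i).posSemidef a b
    rw [covariance_eq_sub (hL a) (hL b), hm, zero_mul, sub_zero] at hcov
    rw [h1, ← hcov]
    rfl
  · -- changing the sign of the `i`-th error alone changes the sign of the product
    refine integral_noiseLaw_eq_zero_of_sign Q (ε := Function.update 1 i (-1)) (fun l => ?_)
      (by fun_prop) fun x => ?_
    · rcases eq_or_ne l i with rfl | hl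
      · simp
      · simp [hl]
    · simp [Function.update_of_ne (Ne.symm h)]

/-- Cauchy–Schwarz with the Frobenius norm of a square root of `A`: if `B Bᵀ = A`, then `B` has
operator norm at most `(tr A)^(1/2)`. -/
lemma norm_mulVec_sq_le {A B : Mat3} (h : B * Bᵀ = A) (x : E3) :
    ‖(WithLp.toLp 2 (B *ᵥ fun a => x a) : E3)‖ ^ 2 ≤ A.trace * ‖x‖ ^ 2 := by
  rw [EuclideanSpace.real_norm_sq_eq, EuclideanSpace.real_norm_sq_eq, ← h, trace, Finset.sum_mul]
  refine Finset.sum_le_sum fun a _ => ?_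
  have := Finset.sum_mul_sq_le_sq_mul_sq Finset.univ (fun b => B a b) (fun b => x b)
  simpa [mulVec, dotProduct, mul_apply, pow_two] using this

open scoped MatrixOrder in
/-- A Gaussian vector `𝒩(0, A)` is `A^(1/2)` times a standard one, so its fourth moment is at most
`(tr A)²` times that of a standard Gaussian vector. -/
lemma integral_norm_pow_four_multivariateGaussian_le {A : Mat3} (hA : A.PosDef) :
    ∫ x : E3, ‖x‖ ^ 4 ∂multivariateGaussian 0 A ≤
      (∫ x : E3, ‖x‖ ^ 4 ∂stdGaussian E3) * A.trace ^ 2 := by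
  have hsq : CFC.sqrt A * (CFC.sqrt A)ᵀ = A := by
    have h1 : (CFC.sqrt A)ᵀ = CFC.sqrt A := by
      have := (CFC.sqrt_nonneg A).isSelfAdjoint.star_eq
      rwa [star_eq_conjTranspose, conjTranspose_eq_transpose_of_trivial] at this
    rw [h1, CFC.sqrt_mul_sqrt_self _ hA.posSemidef.nonneg]
  rw [multivariateGaussian, integral_map (by fun_prop) (by fun_prop), ← integral_mul_const]
  refine integral_mono_of_nonneg (.of_forall fun x => by positivity)
    ((integrable_norm_pow_of_isGaussian _ 4).mul_const _) (.of_forall fun x => ?_)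
  have h2 := norm_mulVec_sq_le hsq x
  have h3 : (0 : E3) + toEuclideanCLM (𝕜 := ℝ) (CFC.sqrt A) x =
      WithLp.toLp 2 (CFC.sqrt A *ᵥ fun a => x a) := by
    rw [zero_add]; rfl
  dsimp only
  rw [h3]
  calc ‖(WithLp.toLp 2 (CFC.sqrt A *ᵥ fun a => x a) : E3)‖ ^ 4
      = (‖(WithLp.toLp 2 (CFC.sqrt A *ᵥ fun a => x a) : E3)‖ ^ 2) ^ 2 := by ring
    _ ≤ (A.trace * ‖x‖ ^ 2) ^ 2 := pow_le_pow_left₀ (by positivity) h2 2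
    _ = ‖x‖ ^ 4 * A.trace ^ 2 := by ring

lemma sum_sq_le_sq_sum_trace {N : ℕ} {Q : Fin N → Mat3} (hQ : ∀ i, (Q i).PosDef) :
    ∑ i, (Q i).trace ^ 2 ≤ (∑ i, (Q i).trace) ^ 2 :=
  Finset.sum_sq_le_sq_sum_of_nonneg fun i _ => (hQ i).posSemidef.trace_nonneg

lemma integral_norm_pow_four_noiseLaw_le {N : ℕ} {Q : Fin N → Mat3} (hQ : ∀ i, (Q i).PosDef) :
    ∫ x, ‖x‖ ^ 4 ∂noiseLaw Q ≤
      (∫ x : E3, ‖x‖ ^ 4 ∂stdGaussian E3) * (∑ i, (Q i).trace) ^ 2 := by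
  have hM : 0 ≤ ∫ x : E3, ‖x‖ ^ 4 ∂stdGaussian E3 := integral_nonneg fun x => by positivity
  calc ∫ x, ‖x‖ ^ 4 ∂noiseLaw Q ≤ ∫ x, ∑ i, ‖x i‖ ^ 4 ∂noiseLaw Q :=
        integral_mono (integrable_norm_pow_noiseLaw Q 4) (integrable_finsetSum Finset.univ
          fun i _ => integrable_norm_apply_pow_noiseLaw Q i 4)
          fun x => norm_pow_le_sum x (by norm_num)
    _ = ∑ i, ∫ x, ‖x‖ ^ 4 ∂multivariateGaussian 0 (Q i) := by
        rw [integral_finsetSum _ fun i _ => integrable_norm_apply_pow_noiseLaw Q i 4]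
        refine Finset.sum_congr rfl fun i _ => ?_
        have hp := measurePreserving_eval_noiseLaw Q i
        rw [← hp.map_eq, integral_map hp.measurable.aemeasurable (by fun_prop)]
    _ ≤ ∑ i, (∫ x : E3, ‖x‖ ^ 4 ∂stdGaussian E3) * (Q i).trace ^ 2 :=
        Finset.sum_le_sum fun i _ => integral_norm_pow_four_multivariateGaussian_le (hQ i)
    _ ≤ _ := by
        rw [← Finset.mul_sum]
        exact mul_le_mul_of_nonneg_left (sum_sq_le_sq_sum_trace hQ) hM

end Gaussian

/-! ### Sigma points -/

section SigmaPoints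

/-- The sigma-point average of a real-valued function: the entrywise form of `sigmaAverage`. -/
noncomputable def sigmaSum {N : ℕ} (κ : ℝ) (S : Fin N → Mat3) (h : (Fin N → E3) → ℝ) : ℝ :=
  κ / (κ + N * 3) * h 0 + ∑ i, ∑ j, 1 / (2 * (κ + N * 3)) * h (sigmaDeviation S i j)

lemma sigmaAverage_apply {N : ℕ} (κ : ℝ) (S : Fin N → Mat3) (g : (Fin N → E3) → Mat3)
    (a b : Fin 3) : sigmaAverage κ S g a b = sigmaSum κ S fun δ => g δ a b := by
  simp [sigmaAverage, sigmaSum, Matrix.sum_apply]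

lemma sigmaDeviation_inr {N : ℕ} (S : Fin N → Mat3) (i : Fin N) (c : Fin 3) :
    sigmaDeviation S i (.inr c) = -sigmaDeviation S i (.inl c) := by
  simp [sigmaDeviation, sigmaOffset, Pi.single_neg]

lemma sigmaSum_sub {N : ℕ} (κ : ℝ) (S : Fin N → Mat3) (g h : (Fin N → E3) → ℝ) :
    sigmaSum κ S (fun x => g x - h x) = sigmaSum κ S g - sigmaSum κ S h := by
  simp only [sigmaSum, mul_sub, Finset.sum_sub_distrib]
  ring

lemma sigmaSum_sum_mul {N : ℕ} {ι : Type*} (κ : ℝ) (S : Fin N → Mat3) (s : Finset ι) (c : ι → ℝ)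
    (h : ι → (Fin N → E3) → ℝ) :
    sigmaSum κ S (fun x => ∑ k ∈ s, c k * h k x) = ∑ k ∈ s, c k * sigmaSum κ S (h k) := by
  simp only [sigmaSum, mul_add, Finset.mul_sum, Finset.sum_add_distrib]
  congr 1
  · exact Finset.sum_congr rfl fun k _ => by ring
  · symm
    rw [Finset.sum_comm]
    refine Finset.sum_congr rfl fun i _ => ?_
    rw [Finset.sum_comm]
    exact Finset.sum_congr rfl fun j _ => Finset.sum_congr rfl fun k _ => by ring

lemma sigmaSum_const {N : ℕ} {κ : ℝ} (hκ : 0 < κ + N * 3) (S : Fin N → Mat3) (c : ℝ) :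
    sigmaSum κ S (fun _ => c) = c := by
  simp only [sigmaSum, Finset.sum_const, Finset.card_univ, Fintype.card_fin, Fintype.card_sum,
    nsmul_eq_mul]
  field_simp
  push_cast
  ring

lemma sigmaSum_eq_zero_of_odd {N : ℕ} (κ : ℝ) (S : Fin N → Mat3) {h : (Fin N → E3) → ℝ}
    (hodd : ∀ x, h (-x) = -h x) : sigmaSum κ S h = 0 := by
  have h0 : h 0 = 0 := by have := hodd 0; rw [neg_zero] at this; linarith
  simp [sigmaSum, h0, Fintype.sum_sum_type, sigmaDeviation_inr, hodd]

lemma sigmaDeviation_inl_apply {N : ℕ} (S : Fin N → Mat3) (l : Fin N) (c : Fin 3)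
    (p : Fin N × Fin 3) :
    sigmaDeviation S l (.inl c) p.1 p.2 = if p.1 = l then S l p.2 c else 0 := by
  simp only [sigmaDeviation, sigmaOffset, Pi.single_apply]
  split_ifs <;> simp [Matrix.col_apply]

lemma sigmaSum_mul {N : ℕ} {κ : ℝ} (hκ : 0 < κ + N * 3) {Q S : Fin N → Mat3}
    (hS : ∀ i, IsSqrtFactor (S i) ((κ + N * 3) • Q i)) (p q : Fin N × Fin 3) :
    sigmaSum κ S (fun x => x p.1 p.2 * x q.1 q.2) = if p.1 = q.1 then Q p.1 p.2 q.2 else 0 := by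
  have hpair : ∀ l c, sigmaDeviation S l (.inl c) p.1 p.2 * sigmaDeviation S l (.inl c) q.1 q.2 =
      if p.1 = l then (if p.1 = q.1 then S p.1 p.2 c * S p.1 q.2 c else 0) else 0 := by
    intro l c
    rw [sigmaDeviation_inl_apply, sigmaDeviation_inl_apply]
    by_cases h1 : p.1 = l
    · subst h1
      by_cases h2 : p.1 = q.1
      · simp [h2]
      · simp [h2, Ne.symm h2]
    · simp [h1]
  simp only [sigmaSum, Fintype.sum_sum_type, sigmaDeviation_inr, Pi.neg_apply, PiLp.neg_apply,
    Pi.zero_apply, PiLp.zero_apply, neg_mul_neg, hpair, mul_zero, zero_add]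
  by_cases h : p.1 = q.1
  · have hQ := congr_fun₂ (hS p.1) p.2 q.2
    simp only [mul_apply, transpose_apply, Matrix.smul_apply, smul_eq_mul] at hQ
    simp_rw [if_pos h]
    rw [Finset.sum_eq_single p.1 (fun l _ hl => by simp [Ne.symm hl]) (by simp)]
    simp only [if_true, ← Finset.mul_sum, hQ]
    field_simp
    ring
  · simp [h]

/-- Any bilinear form of the deviation is a linear combination of products of two coordinates. -/
lemma multilinear_two_eq_sum {N : ℕ}
    (m : ContinuousMultilinearMap ℝ (fun _ : Fin 2 => Fin N → E3) ℝ) (x : Fin N → E3) :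
    m (fun _ => x) = ∑ ρ : Fin 2 → Fin N × Fin 3,
      m (fun k => Pi.single (ρ k).1 (EuclideanSpace.single (ρ k).2 (1 : ℝ))) *
        (x (ρ 0).1 (ρ 0).2 * x (ρ 1).1 (ρ 1).2) := by
  have hx : x = ∑ p : Fin N × Fin 3,
      x p.1 p.2 • Pi.single (M := fun _ => E3) p.1 (EuclideanSpace.single p.2 (1 : ℝ)) := by
    ext i a
    rw [Fintype.sum_prod_type]
    simp [Finset.sum_apply, Pi.single_apply, apply_ite]
  conv_lhs => rw [hx]
  rw [m.map_sum]
  refine Finset.sum_congr rfl fun ρ _ => ?_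
  rw [m.map_smul_univ, Fin.prod_univ_two, smul_eq_mul, mul_comm]

/-- The sigma points reproduce the moments of the noise up to order three: odd moments vanish on
both sides by symmetry, and the second moments agree by the choice of the square roots. -/
lemma integral_multilinear_eq_sigmaSum {N : ℕ} {κ : ℝ} (hκ : 0 < κ + N * 3) {Q S : Fin N → Mat3}
    (hQ : ∀ i, (Q i).PosDef) (hS : ∀ i, IsSqrtFactor (S i) ((κ + N * 3) • Q i)) {k : ℕ}
    (hk : k ≤ 3) (m : ContinuousMultilinearMap ℝ (fun _ : Fin k => Fin N → E3) ℝ) :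
    ∫ x, m (fun _ => x) ∂noiseLaw Q = sigmaSum κ S fun x => m fun _ => x := by
  have hodd : Odd k → ∫ x, m (fun _ => x) ∂noiseLaw Q = sigmaSum κ S fun x => m fun _ => x := by
    intro hko
    have hm : ∀ x, m (fun _ => -x) = -m fun _ => x := fun x => by
      have := m.map_smul_univ (fun _ => (-1 : ℝ)) fun _ => x
      simpa [hko.neg_one_pow] using this
    rw [sigmaSum_eq_zero_of_odd κ S hm]
    refine integral_noiseLaw_eq_zero_of_sign Q (ε := fun _ => -1) (fun _ => Or.inr rfl)
      (m.cont.comp (continuous_pi fun _ => continuous_id)) fun x => ?_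
    rw [← hm]
    congr 1
    ext1
    funext i
    simp
  interval_cases k
  · have hm : ∀ x, m (fun _ => x) = m 0 := fun x => congr_arg m (Subsingleton.elim _ _)
    simp_rw [hm]
    rw [sigmaSum_const hκ]
    simp
  · exact hodd (by decide)
  · simp_rw [multilinear_two_eq_sum m]
    rw [integral_finsetSum _ fun ρ _ => (integrable_mul_noiseLaw Q (ρ 0) (ρ 1)).const_mul _,
      sigmaSum_sum_mul κ S Finset.univ _ fun (ρ : Fin 2 → Fin N × Fin 3) (x : Fin N → E3) =>
        x (ρ 0).1 (ρ 0).2 * x (ρ 1).1 (ρ 1).2]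
    refine Finset.sum_congr rfl fun ρ _ => ?_
    rw [integral_const_mul, integral_mul_noiseLaw hQ, sigmaSum_mul hκ hS]
  · exact hodd (by decide)

lemma norm_sigmaDeviation_sq_le {N : ℕ} {κ : ℝ} {Q S : Fin N → Mat3}
    (hS : ∀ i, IsSqrtFactor (S i) ((κ + N * 3) • Q i)) (i : Fin N) (j : Fin 3 ⊕ Fin 3) :
    ‖sigmaDeviation S i j‖ ^ 2 ≤ (κ + N * 3) * (Q i).trace := by
  have key : ∀ c, ‖sigmaDeviation S i (.inl c)‖ ^ 2 ≤ (κ + N * 3) * (Q i).trace := by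
    intro c
    have h := norm_mulVec_sq_le (hS i) (EuclideanSpace.single c 1)
    rw [trace_smul, smul_eq_mul, PiLp.norm_single] at h
    have h2 : (S i *ᵥ fun a => (EuclideanSpace.single c (1 : ℝ) : E3) a) = (S i).col c := by
      have : (fun a => (EuclideanSpace.single c (1 : ℝ) : E3) a) = Pi.single c 1 := rfl
      rw [this, mulVec_single_one]
    rw [h2] at h
    simpa [sigmaDeviation, sigmaOffset, Pi.norm_single] using h
  rcases j with c | c
  · exact key c
  · rw [sigmaDeviation_inr, norm_neg]
    exact key c

lemma abs_sigmaSum_le {N : ℕ} {κ : ℝ} (hκ : 0 < κ + N * 3) {Q S : Fin N → Mat3}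
    (hQ : ∀ i, (Q i).PosDef) (hS : ∀ i, IsSqrtFactor (S i) ((κ + N * 3) • Q i))
    {h : (Fin N → E3) → ℝ} {C : ℝ} (hC : 0 ≤ C) (hh : ∀ x, |h x| ≤ C * ‖x‖ ^ 4) :
    |sigmaSum κ S h| ≤ C * (3 * (κ + N * 3)) * (∑ i, (Q i).trace) ^ 2 := by
  have h0 : h 0 = 0 := by simpa using hh 0
  have hterm : ∀ i j, |1 / (2 * (κ + N * 3)) * h (sigmaDeviation S i j)| ≤
      C * ((κ + N * 3) / 2) * (Q i).trace ^ 2 := by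
    intro i j
    have h1 := pow_le_pow_left₀ (by positivity) (norm_sigmaDeviation_sq_le hS i j) 2
    rw [abs_mul, abs_of_pos (by positivity)]
    calc 1 / (2 * (κ + N * 3)) * |h (sigmaDeviation S i j)|
        ≤ 1 / (2 * (κ + N * 3)) * (C * ((κ + N * 3) * (Q i).trace) ^ 2) := by
          refine mul_le_mul_of_nonneg_left ((hh _).trans ?_) (by positivity)
          refine mul_le_mul_of_nonneg_left ?_ hC
          rwa [← pow_mul] at h1
      _ = _ := by field_simp
  rw [sigmaSum, h0, mul_zero, zero_add]
  calc _ ≤ ∑ i, ∑ j, |1 / (2 * (κ + N * 3)) * h (sigmaDeviation S i j)| :=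
        (Finset.abs_sum_le_sum_abs _ _).trans
          (Finset.sum_le_sum fun i _ => Finset.abs_sum_le_sum_abs _ _)
    _ ≤ ∑ i, ∑ _j : Fin 3 ⊕ Fin 3, C * ((κ + N * 3) / 2) * (Q i).trace ^ 2 :=
        Finset.sum_le_sum fun i _ => Finset.sum_le_sum fun j _ => hterm i j
    _ = C * (3 * (κ + N * 3)) * ∑ i, (Q i).trace ^ 2 := by
        rw [Finset.mul_sum]
        refine Finset.sum_congr rfl fun i _ => ?_
        simp
        ring
    _ ≤ _ := mul_le_mul_of_nonneg_left (sum_sq_le_sq_sum_trace hQ) (by positivity)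

/-- The unscented average integrates the Taylor polynomial of order three exactly, so its error is
controlled by the fourth-order remainder `|g (z + δ) - T δ| ≤ C ‖δ‖ ^ 4` alone. -/
lemma exists_abs_integral_sub_sigmaSum_le {N : ℕ} {κ : ℝ} (hκ : 0 < κ + N * 3)
    {g : (Fin N → E3) → ℝ} {z : Fin N → E3} (hgm : Measurable g) {B : ℝ} (hB : ∀ x, |g x| ≤ B)
    (hg : ContDiffAt ℝ (3 + 1 : ℕ) g z) :
    ∃ C, 0 ≤ C ∧ ∀ Q S : Fin N → Mat3, (∀ i, (Q i).PosDef) →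
      (∀ i, IsSqrtFactor (S i) ((κ + N * 3) • Q i)) →
      |∫ x, g (z + x) ∂noiseLaw Q - sigmaSum κ S fun x => g (z + x)| ≤
        C * (∑ i, (Q i).trace) ^ 2 := by
  obtain ⟨C, hC, hT⟩ := exists_abs_sub_taylor_le hg hB
  set M := ∫ x : E3, ‖x‖ ^ 4 ∂stdGaussian E3 with hM
  have hM0 : 0 ≤ M := integral_nonneg fun x => by positivity
  refine ⟨C * M + C * (3 * (κ + N * 3)), by positivity, fun Q S hQ hS => ?_⟩
  set T : (Fin N → E3) → ℝ := fun δ => ∑ k ∈ Finset.range (3 + 1),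
      ((k.factorial : ℝ)⁻¹) * iteratedFDeriv ℝ k g z fun _ => δ with hTdef
  have hTint : ∀ k, Integrable (fun x => ((k.factorial : ℝ)⁻¹) * iteratedFDeriv ℝ k g z fun _ => x)
      (noiseLaw Q) := fun k => (integrable_multilinear_noiseLaw Q _).const_mul _
  have hTeq : ∫ x, T x ∂noiseLaw Q = sigmaSum κ S T := by
    rw [hTdef, integral_finsetSum _ fun k _ => hTint k, sigmaSum_sum_mul]
    refine Finset.sum_congr rfl fun k hk => ?_
    rw [integral_const_mul, integral_multilinear_eq_sigmaSum hκ hQ hS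
      (Nat.lt_succ_iff.1 (Finset.mem_range.1 hk))]
  have hgint : Integrable (fun x => g (z + x)) (noiseLaw Q) :=
    .of_bound (hgm.comp (measurable_const_add z)).aestronglyMeasurable B (.of_forall fun x => hB _)
  have hTi : Integrable T (noiseLaw Q) := integrable_finsetSum _ fun k _ => hTint k
  have h1 : ∫ x, g (z + x) ∂noiseLaw Q - sigmaSum κ S (fun x => g (z + x)) =
      ∫ x, (g (z + x) - T x) ∂noiseLaw Q - sigmaSum κ S fun x => g (z + x) - T x := by
    rw [integral_sub hgint hTi, sigmaSum_sub, hTeq]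
    ring
  rw [h1, add_mul]
  refine (abs_sub _ _).trans (add_le_add ?_ (abs_sigmaSum_le hκ hQ hS hC hT))
  calc |∫ x, (g (z + x) - T x) ∂noiseLaw Q| = ‖∫ x, (g (z + x) - T x) ∂noiseLaw Q‖ :=
        (Real.norm_eq_abs _).symm
    _ ≤ ∫ x, C * ‖x‖ ^ 4 ∂noiseLaw Q :=
        norm_integral_le_of_norm_le ((integrable_norm_pow_noiseLaw Q 4).const_mul C)
          (.of_forall hT)
    _ = C * ∫ x, ‖x‖ ^ 4 ∂noiseLaw Q := integral_const_mul _ _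
    _ ≤ C * (M * (∑ i, (Q i).trace) ^ 2) :=
        mul_le_mul_of_nonneg_left (integral_norm_pow_four_noiseLaw_le hQ) hC
    _ = _ := by ring

end SigmaPoints

/-! ### Accuracy of the unscented mean -/

theorem proposition2 {N : ℕ} (r : Fin N → E3) (f : (Fin N → E3) → Mat3) (hf : IsSVDMethod r f)
    (κ : ℝ) (hκ : 0 < κ + N * 3) :
    -- at noise-free measurements of non-collinear references, the SVD attitude is the true one
    (∀ R₀ ∈ Matrix.specialOrthogonalGroup (Fin 3) ℝ,
      (∃ i j, LinearIndependent ℝ ![r i, r j]) →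
        ∀ R, IsSVDAttitude r (noiseFree r R₀) R ↔ R = R₀) ∧
    -- at every centre where the SVD attitude is unique, the unscented mean is third-order accurate
    (∀ z : Fin N → E3, (∃! R, IsSVDAttitude r z R) →
      (∀ a b, ContDiffAt ℝ (⊤ : ℕ∞) (fun Z => f Z a b) z) ∧
      ∃ C : ℝ, ∀ (Ω : Type*) [MeasurableSpace Ω] (P : Measure Ω) [IsProbabilityMeasure P]
        (v : Fin N → Ω → E3) (Q S : Fin N → Mat3),
        IsGaussianNoise P v Q →
        (∀ i, IsSqrtFactor (S i) ((κ + N * 3) • Q i)) →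
          -- the terms of order at most three in the two Taylor expansions agree
          (∀ k : ℕ, k ≤ 3 →
            HasFirstMoment P (fun ω => taylorTerm f z k fun i => v i ω) ∧
            firstMoment P (fun ω => taylorTerm f z k fun i => v i ω) =
              sigmaAverage κ S (taylorTerm f z k)) ∧
          -- and the error of the unscented mean is of fourth order in the noise
          HasFirstMoment P (fun ω => f (z + fun i => v i ω)) ∧
          ∀ a b, |firstMoment P (fun ω => f (z + fun i => v i ω)) a b - unscentedMean κ S f z a b|
            ≤ C * (∑ i, (Q i).trace) ^ 2) := by
  refine ⟨fun R₀ hR₀ hr R => ⟨fun h => h.eq_of_noiseFree hR₀ hr, ?_⟩, fun z hz => ?_⟩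
  · -- an attitude exists, and by the other direction it can only be `R₀`
    rintro rfl
    have h := hf.attitude (noiseFree r R)
    rwa [h.eq_of_noiseFree hR₀ hr] at h
  have hsmooth := fun a b => hf.contDiffAt_apply hz a b
  refine ⟨hsmooth, ?_⟩
  have hbound : ∀ a b Z, |f Z a b| ≤ 1 := fun a b Z => abs_entry_le_one (hf.attitude Z).mem a b
  choose C hC0 hC using fun a b => exists_abs_integral_sub_sigmaSum_le hκ (hf.measurable a b)
    (hbound a b) (contDiffAt_infty.1 (hsmooth a b) (3 + 1))
  refine ⟨∑ a, ∑ b, C a b, fun Ω _ P _ v Q S hv hS => ⟨fun k hk => ?_, ?_, fun a b => ?_⟩⟩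
  · have hlaw := hv.hasLaw
    have hint : ∀ a b, Integrable (fun x => iteratedFDeriv ℝ k (fun Z => f Z a b) z fun _ => x)
        (noiseLaw Q) := fun a b => integrable_multilinear_noiseLaw Q _
    refine ⟨fun a b => ?_, ?_⟩
    · have h := hint a b
      rw [← hlaw.map_eq] at h
      exact h.comp_aemeasurable hlaw.aemeasurable
    · ext a b
      rw [sigmaAverage_apply]
      exact (hlaw.integral_comp (hint a b).aestronglyMeasurable).trans
        (integral_multilinear_eq_sigmaSum hκ hv.posDef hS hk _)
  · intro a b
    refine .of_bound ?_ 1 (.of_forall fun ω => hbound a b _)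
    exact ((hf.measurable a b).comp_aemeasurable
      (hv.hasLaw.aemeasurable.const_add z)).aestronglyMeasurable
  · have h1 : firstMoment P (fun ω => f (z + fun i => v i ω)) a b =
        ∫ x, f (z + x) a b ∂noiseLaw Q :=
      hv.hasLaw.integral_comp (f := fun x => f (z + x) a b)
        ((hf.measurable a b).comp (measurable_const_add z)).aestronglyMeasurable
    have h2 : C a b ≤ ∑ a, ∑ b, C a b :=
      (Finset.single_le_sum (f := C a) (fun b _ => hC0 a b) (Finset.mem_univ b)).trans
        (Finset.single_le_sum (f := fun a => ∑ b, C a b)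
          (fun a _ => Finset.sum_nonneg fun b _ => hC0 a b) (Finset.mem_univ a))
    rw [h1, unscentedMean, sigmaAverage_apply]
    exact (hC a b Q S hv.posDef hS).trans (mul_le_mul_of_nonneg_right h2 (sq_nonneg _))
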